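/- Let $H$ be a real Hilbert space and let $F, G : H \to [0,\infty]$ be proper (not everywhere equal to $\infty$), lower semicontinuous, convex functionals such that, for some $\delta \ge 0$, $$F(x) - \delta \le G(x) \le F(x) + \delta \qquad \text{for all } x \in H.$$ Suppose that $u^*$ minimizes $F$ and $v^*$ minimizes $G$, and let $E, M \ge 0$ and $u_0, v_0 \in H$ be such that $F(u_0) \le E$, $G(v_0) \le E$, $\|u_0 - u^*\| \le M$ and $\|v_0 - v^*\| \le M$. Let $u : [0,\infty) \to H$ be the Brezis–Komura gradient flow of $F$ starting at $u_0$ and $v : [0,\infty) \to H$ the one of $G$ starting at $v_0$. Then $$\|u(t) - v(t)\| \le 16\,(M E \delta t^2)^{1/5} + \|u_0 - v_0\|$$ for all $0 \le t \le E^6 M^6/\delta^9$ (for all $t \ge 0$, if $\delta = 0$). Here the gradient flow of $F$ starting at $u_0$ is the locally absolutely continuous curve $u$ with $u(0) = u_0 = \lim_{t \downarrow 0} u(t)$ and $-u'(t) = \operatorname{grad} F(u(t))$ for almost every $t > 0$, where $\operatorname{grad} F(x)$ is the element of minimal norm of the subdifferential $\partial F(x) = \{ z \in H : \langle z, y - x\rangle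 \le F(y) - F(x) \text{ for all } y \in H \}$ at a point $x$ with $F(x) < \infty$. -/

import Mathlib

open MeasureTheory Set Filter Topology
open scoped NNReal ENNReal

/-- The class of functionals `F : H → [0,∞]` on a real Hilbert space that are proper
(not everywhere `∞`), lower semicontinuous and convex. Convexity is Mathlib's `ConvexOn`,
with weights `a b : ℝ≥0`, `a + b = 1`, acting on the values in `[0,∞]`. -/
structure IsProperLscConvex {H : Type*} [NormedAddCommGroup H] [InnerProductSpace ℝ H]
    (F : H → ℝ≥0∞) : Prop where
  proper : ∃ x, F x ≠ ∞
  lsc : LowerSemicontinuous F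
  convex : ConvexOn ℝ≥0 univ F

/-- The subdifferential of `F` at a point `x` of the finiteness domain of `F`: all `z` with
`⟪z, y - x⟫ ≤ F y - F x` for all `y`. The inequality holds trivially when `F y = ∞`, so it
is only asked for `y` in the finiteness domain. It is empty when `F x = ∞`. -/
def subdifferential {H : Type*} [NormedAddCommGroup H] [InnerProductSpace ℝ H]
    (F : H → ℝ≥0∞) (x : H) : Set H :=
  {z | F x ≠ ∞ ∧ ∀ y, F y ≠ ∞ → inner ℝ z (y - x) ≤ (F y).toReal - (F x).toReal}

/-- `z` is the gradient of `F` at `x`: the element of minimal norm of the subdifferential. -/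
def IsGradOf {H : Type*} [NormedAddCommGroup H] [InnerProductSpace ℝ H]
    (F : H → ℝ≥0∞) (x z : H) : Prop :=
  z ∈ subdifferential F x ∧ ∀ w ∈ subdifferential F x, ‖z‖ ≤ ‖w‖

/-- `u : [0,∞) → H` is the (Brezis–Komura) gradient flow of `F` starting at `x₀`: it starts at
`x₀`, tends to `x₀` as `t ↓ 0`, is absolutely continuous on each compact subinterval of
`(0,∞)`, and is differentiable with `-u'(t) = grad F (u t)` for almost every `t > 0`. (A curve
that is locally absolutely continuous on `[0,∞)` satisfies this regularity requirement, too.)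
The values of `u` at negative times play no role. -/
structure IsGradientFlow {H : Type*} [NormedAddCommGroup H] [InnerProductSpace ℝ H]
    (F : H → ℝ≥0∞) (x₀ : H) (u : ℝ → H) : Prop where
  initial : u 0 = x₀
  tendsto_initial : Tendsto u (𝓝[>] 0) (𝓝 x₀)
  absolutelyContinuous : ∀ a b : ℝ, 0 < a → a ≤ b → AbsolutelyContinuousOnInterval u a b
  hasDerivAt : ∀ᵐ t ∂(volume.restrict (Ioi (0 : ℝ))),
    ∃ z, IsGradOf F (u t) z ∧ HasDerivAt u (-z) t

/-!
Testing the flow against points of the finiteness domain gives everything. If `z = grad F (u t)`,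
the subgradient inequality at `x` reads `⟪z, x - u t⟫ ≤ F x - F (u t)`, so for almost every `t`
the derivative of `‖u t - x‖²` is at most `2 (F x - F (u t))`
(`IsGradientFlow.sq_norm_sub_le`). Taking for `x` the minimizer yields `‖u t - u*‖ ≤ M`, hence
`‖u t - u₀‖ ≤ 2 M`; taking `x = u₀` yields `‖u t - u₀‖² ≤ 2 E t`. Testing the two flows against
each other, the values of `F` and `G` cancel up to `2 δ`, and `‖u t - v t‖² ≤ ‖u₀ - v₀‖² + 4 δ t`
(`IsGradientFlow.sq_norm_sub_le_of_close`).

Therefore the excess `a = ‖u t - v t‖ - ‖u₀ - v₀‖`, when nonnegative, satisfies `a ≤ 4 M`,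
`a² ≤ 8 E t` and `a² ≤ 4 δ t`. The product of these three bounds is `a⁵ ≤ 128 M E δ t²`, and
`128 ≤ 16⁵`.

The differential inequalities are integrated for the real function `‖w‖²`, which is absolutely
continuous when the curve `w` is (`sq_norm_le_of_ae_inner_deriv_le`).
-/

section Curves

variable {H : Type*} [NormedAddCommGroup H]

theorem AbsolutelyContinuousOnInterval.norm {w : ℝ → H} {a b : ℝ}
    (hw : AbsolutelyContinuousOnInterval w a b) :
    AbsolutelyContinuousOnInterval (fun s ↦ ‖w s‖) a b :=
  squeeze_zero (fun _ ↦ Finset.sum_nonneg fun _ _ ↦ dist_nonneg)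
    (fun _ ↦ Finset.sum_le_sum fun _ _ ↦ by
      simpa only [dist_eq_norm, Real.norm_eq_abs] using abs_norm_sub_norm_le _ _) hw

theorem absolutelyContinuousOnInterval_const (x : H) (a b : ℝ) :
    AbsolutelyContinuousOnInterval (fun _ : ℝ ↦ x) a b :=
  (LipschitzWith.const x).lipschitzOnWith.absolutelyContinuousOnInterval

theorem AbsolutelyContinuousOnInterval.sub_le_mul_of_ae_deriv_le {f : ℝ → ℝ} {a b c : ℝ}
    (hab : a ≤ b) (hf : AbsolutelyContinuousOnInterval f a b)
    (hc : ∀ᵐ s ∂(volume.restrict (Icc a b)), deriv f s ≤ c) :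
    f b - f a ≤ c * (b - a) := by
  rw [← hf.integral_deriv_eq_sub]
  calc ∫ s in a..b, deriv f s ≤ ∫ _ in a..b, c :=
        intervalIntegral.integral_mono_ae_restrict hab hf.intervalIntegrable_deriv
          intervalIntegrable_const hc
    _ = c * (b - a) := by simp [mul_comm]

/-- A differential inequality `(‖w‖²)' ≤ 2 c` integrates up to the initial time, although
absolute continuity is only known away from it. -/
theorem sq_norm_le_of_ae_inner_deriv_le [InnerProductSpace ℝ H] {w : ℝ → H} {w₀ : H} {c : ℝ}
    (hw₀ : Tendsto w (𝓝[>] 0) (𝓝 w₀))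
    (hac : ∀ a b : ℝ, 0 < a → a ≤ b → AbsolutelyContinuousOnInterval w a b)
    (hder : ∀ᵐ s ∂(volume.restrict (Ioi (0 : ℝ))),
      ∃ w', HasDerivAt w w' s ∧ inner ℝ (w s) w' ≤ c)
    {t : ℝ} (ht : 0 < t) : ‖w t‖ ^ 2 ≤ ‖w₀‖ ^ 2 + 2 * c * t := by
  have hstep : ∀ᶠ a in 𝓝[>] (0 : ℝ), ‖w t‖ ^ 2 ≤ ‖w a‖ ^ 2 + 2 * c * (t - a) := by
    filter_upwards [Ioo_mem_nhdsGT ht] with a ha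
    have hsq : AbsolutelyContinuousOnInterval (fun s ↦ ‖w s‖ ^ 2) a t := by
      simpa only [sq] using (hac a t ha.1 ha.2.le).norm.fun_mul (hac a t ha.1 ha.2.le).norm
    have hle := hsq.sub_le_mul_of_ae_deriv_le (c := 2 * c) ha.2.le <| by
      have hsub : Icc a t ⊆ Ioi 0 := fun s hs ↦ ha.1.trans_le hs.1
      filter_upwards [ae_restrict_of_ae_restrict_of_subset hsub hder] with s ⟨w', hw', hin⟩
      rw [hw'.norm_sq.deriv]
      linarith
    linarith
  have hlim : Tendsto (fun a ↦ ‖w a‖ ^ 2 + 2 * c * (t - a)) (𝓝[>] 0)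
      (𝓝 (‖w₀‖ ^ 2 + 2 * c * (t - 0))) :=
    (hw₀.norm.pow 2).add
      (((tendsto_id.mono_left nhdsWithin_le_nhds).const_sub t).const_mul (2 * c))
  simpa using ge_of_tendsto hlim hstep

end Curves

section Flows

variable {H : Type*} [NormedAddCommGroup H] [InnerProductSpace ℝ H]
  {F G : H → ℝ≥0∞} {u₀ v₀ : H} {u v : ℝ → H}

/-- The evolution variational inequality, with the energy difference bounded by a constant. -/
theorem IsGradientFlow.sq_norm_sub_le (hu : IsGradientFlow F u₀ u) {x : H} {c : ℝ}
    (hx : F x ≠ ∞) (hc : ∀ y, F y ≠ ∞ → (F x).toReal - (F y).toReal ≤ c) {t : ℝ} (ht : 0 < t) :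
    ‖u t - x‖ ^ 2 ≤ ‖u₀ - x‖ ^ 2 + 2 * c * t := by
  refine sq_norm_le_of_ae_inner_deriv_le (w := fun s ↦ u s - x)
    (hu.tendsto_initial.sub_const x)
    (fun a b ha hab ↦ (hu.absolutelyContinuous a b ha hab).fun_sub
      (absolutelyContinuousOnInterval_const x a b)) ?_ ht
  filter_upwards [hu.hasDerivAt] with s ⟨z, hz, hd⟩
  refine ⟨-z, hd.sub_const x, ?_⟩
  have hsub := hz.1.2 x hx
  have hin : inner ℝ (u s - x) (-z) = inner ℝ z (x - u s) := by
    rw [inner_neg_right, ← inner_neg_left, neg_sub, real_inner_comm]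
  linarith [hc (u s) hz.1.1]

theorem IsGradientFlow.norm_sub_minimizer_le (hu : IsGradientFlow F u₀ u) {x : H}
    (hmin : IsMinOn F univ x) (hx : F x ≠ ∞) {t : ℝ} (ht : 0 < t) :
    ‖u t - x‖ ≤ ‖u₀ - x‖ := by
  have h := hu.sq_norm_sub_le hx (c := 0)
    (fun y hy ↦ sub_nonpos.2 (ENNReal.toReal_mono hy (hmin (mem_univ y)))) ht
  exact le_of_pow_le_pow_left₀ two_ne_zero (norm_nonneg _) (by linarith)

theorem IsGradientFlow.sq_norm_sub_initial_le (hu : IsGradientFlow F u₀ u) {E : ℝ}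
    (hE : 0 ≤ E) (hu₀ : F u₀ ≤ ENNReal.ofReal E) {t : ℝ} (ht : 0 < t) :
    ‖u t - u₀‖ ^ 2 ≤ 2 * E * t := by
  have h := hu.sq_norm_sub_le (hu₀.trans_lt ENNReal.ofReal_lt_top).ne (c := E)
    (fun y _ ↦ by linarith [ENNReal.toReal_le_of_le_ofReal hE hu₀,
      ENNReal.toReal_nonneg (a := F y)]) ht
  simpa using h

/-- Gradient flows of uniformly close functionals separate at most like `2 √(δ t)`. -/
theorem IsGradientFlow.sq_norm_sub_le_of_close (hu : IsGradientFlow F u₀ u)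
    (hv : IsGradientFlow G v₀ v) {δ : ℝ} (hδ : 0 ≤ δ)
    (hFG : ∀ x, F x ≤ G x + ENNReal.ofReal δ ∧ G x ≤ F x + ENNReal.ofReal δ)
    {t : ℝ} (ht : 0 < t) :
    ‖u t - v t‖ ^ 2 ≤ ‖u₀ - v₀‖ ^ 2 + 4 * δ * t := by
  -- The two functionals have the same finiteness domain, on which they differ by at most `δ`.
  have transfer : ∀ {p q : ℝ≥0∞}, p ≤ q + ENNReal.ofReal δ → q ≠ ∞ →
      p ≠ ∞ ∧ p.toReal ≤ q.toReal + δ := fun {p q} hpq hq ↦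
    ⟨ne_top_of_le_ne_top (ENNReal.add_ne_top.2 ⟨hq, ENNReal.ofReal_ne_top⟩) hpq, by
      simpa [ENNReal.toReal_add hq, hδ] using
        ENNReal.toReal_mono (ENNReal.add_ne_top.2 ⟨hq, ENNReal.ofReal_ne_top⟩) hpq⟩
  have key : ‖u t - v t‖ ^ 2 ≤ ‖u₀ - v₀‖ ^ 2 + 2 * (2 * δ) * t := by
    refine sq_norm_le_of_ae_inner_deriv_le (w := fun s ↦ u s - v s)
      (hu.tendsto_initial.sub hv.tendsto_initial)
      (fun a b ha hab ↦ (hu.absolutelyContinuous a b ha hab).fun_sub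
        (hv.absolutelyContinuous a b ha hab)) ?_ ht
    filter_upwards [hu.hasDerivAt, hv.hasDerivAt] with s ⟨z, hz, hzd⟩ ⟨y, hy, hyd⟩
    refine ⟨-z - -y, hzd.sub hyd, ?_⟩
    obtain ⟨hGu, hGu_le⟩ := transfer (hFG (u s)).2 hz.1.1
    obtain ⟨hFv, hFv_le⟩ := transfer (hFG (v s)).1 hy.1.1
    have h₁ := hz.1.2 (v s) hFv
    have h₂ := hy.1.2 (u s) hGu
    have hin : inner ℝ (u s - v s) (-z - -y)
        = inner ℝ z (v s - u s) + inner ℝ y (u s - v s) := by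
      simp only [inner_sub_left, inner_sub_right, inner_neg_right, real_inner_comm]
      ring
    linarith
  linarith

end Flows

theorem theorem2 {H : Type*} [NormedAddCommGroup H] [InnerProductSpace ℝ H] [CompleteSpace H]
    (F G : H → ℝ≥0∞) (hF : IsProperLscConvex F) (hG : IsProperLscConvex G)
    (δ E M : ℝ) (hδ : 0 ≤ δ) (hE : 0 ≤ E) (hM : 0 ≤ M)
    -- `F - δ ≤ G ≤ F + δ` everywhere
    (hFG : ∀ x, F x ≤ G x + ENNReal.ofReal δ ∧ G x ≤ F x + ENNReal.ofReal δ)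
    -- initial data, with energies at most `E`
    (u₀ v₀ : H) (hu₀E : F u₀ ≤ ENNReal.ofReal E) (hv₀E : G v₀ ≤ ENNReal.ofReal E)
    -- minimizers of `F` and `G`, at distance at most `M` from the initial data
    (uStar vStar : H) (huStar : IsMinOn F univ uStar) (hvStar : IsMinOn G univ vStar)
    (hu₀M : ‖u₀ - uStar‖ ≤ M) (hv₀M : ‖v₀ - vStar‖ ≤ M)
    -- the gradient flows
    (u v : ℝ → H) (hu : IsGradientFlow F u₀ u) (hv : IsGradientFlow G v₀ v)
    -- the time range (the upper limit is infinite when `δ = 0`)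
    (t : ℝ) (ht₀ : 0 ≤ t) (ht : 0 < δ → t ≤ E ^ 6 * M ^ 6 / δ ^ 9) :
    ‖u t - v t‖ ≤ 16 * (M * E * δ * t ^ 2) ^ ((1 : ℝ) / 5) + ‖u₀ - v₀‖ := by
  have hP : 0 ≤ M * E * δ * t ^ 2 := by positivity
  have hR : 0 ≤ (M * E * δ * t ^ 2) ^ ((1 : ℝ) / 5) := Real.rpow_nonneg hP _
  have hR5 : ((M * E * δ * t ^ 2) ^ ((1 : ℝ) / 5)) ^ 5 = M * E * δ * t ^ 2 := by
    rw [← Real.rpow_natCast, ← Real.rpow_mul hP]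
    norm_num
  rcases ht₀.eq_or_lt with rfl | htpos
  · rw [hu.initial, hv.initial]
    linarith
  have hFs : F uStar ≠ ∞ :=
    (((huStar (mem_univ u₀)).trans hu₀E).trans_lt ENNReal.ofReal_lt_top).ne
  have hGs : G vStar ≠ ∞ :=
    (((hvStar (mem_univ v₀)).trans hv₀E).trans_lt ENNReal.ofReal_lt_top).ne
  have hu1 : ‖u t - u₀‖ ≤ 2 * M := by
    have := norm_sub_le_norm_sub_add_norm_sub (u t) uStar u₀
    rw [norm_sub_rev uStar] at this
    linarith [hu.norm_sub_minimizer_le huStar hFs htpos]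
  have hv1 : ‖v t - v₀‖ ≤ 2 * M := by
    have := norm_sub_le_norm_sub_add_norm_sub (v t) vStar v₀
    rw [norm_sub_rev vStar] at this
    linarith [hv.norm_sub_minimizer_le hvStar hGs htpos]
  have hu2 := hu.sq_norm_sub_initial_le hE hu₀E htpos
  have hv2 := hv.sq_norm_sub_initial_le hE hv₀E htpos
  have hclose := hu.sq_norm_sub_le_of_close hv hδ hFG htpos
  have htri : ‖u t - v t‖ ≤ ‖u t - u₀‖ + ‖u₀ - v₀‖ + ‖v t - v₀‖ := by
    have h₁ := norm_sub_le_norm_sub_add_norm_sub (u t) u₀ (v t)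
    have h₂ := norm_sub_le_norm_sub_add_norm_sub u₀ v₀ (v t)
    rw [norm_sub_rev v₀] at h₂
    linarith
  have hd : 0 ≤ ‖u₀ - v₀‖ := norm_nonneg _
  obtain ⟨a, ha⟩ : ∃ a, a = ‖u t - v t‖ - ‖u₀ - v₀‖ := ⟨_, rfl⟩
  rcases le_or_gt a 0 with ha0 | ha0
  · linarith
  have haM : a ≤ 4 * M := by linarith
  have haE : a ^ 2 ≤ 8 * E * t := by
    have hle : a ≤ ‖u t - u₀‖ + ‖v t - v₀‖ := by linarith
    calc a ^ 2 ≤ (‖u t - u₀‖ + ‖v t - v₀‖) ^ 2 := by gcongr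
      _ ≤ 2 * (‖u t - u₀‖ ^ 2 + ‖v t - v₀‖ ^ 2) := add_sq_le
      _ ≤ 8 * E * t := by linarith
  have haδ : a ^ 2 ≤ 4 * δ * t := by
    have heq : ‖u t - v t‖ = a + ‖u₀ - v₀‖ := by linarith
    rw [heq] at hclose
    nlinarith [mul_nonneg ha0.le hd]
  have ha5 : a ^ 5 ≤ (16 * (M * E * δ * t ^ 2) ^ ((1 : ℝ) / 5)) ^ 5 := by
    calc a ^ 5 = a * (a ^ 2 * a ^ 2) := by ring
      _ ≤ 4 * M * (8 * E * t * (4 * δ * t)) := by gcongr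
      _ = 128 * (M * E * δ * t ^ 2) := by ring
      _ ≤ 16 ^ 5 * (M * E * δ * t ^ 2) := by gcongr; norm_num
      _ = _ := by rw [mul_pow, hR5]
  have := le_of_pow_le_pow_left₀ (by norm_num) (by positivity) ha5
  linarith
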